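/- Let $d\ge 1$ and $\mathbb N=\{1,2,\dots\}$. Let $\{A_n\}_{n\in\mathbb N}$, $\{B_n\}_{n\in\mathbb N}$ be complex $d\times d$ matrices with every $A_n$ invertible and every $B_n$ Hermitian. For a sequence $u=\{u_n\}$ of vectors in $\mathbb C^d$ put $$(\mathcal J u)_1=B_1u_1+A_1u_2,\qquad (\mathcal J u)_n=A_{n-1}^*u_{n-1}+B_nu_n+A_nu_{n+1}\quad(n\ge 2).$$ Let $J_{\min}$ be the restriction of $\mathcal J$ to the finite sequences in $\ell^2(\mathbb N;\mathbb C^d)$, let $J_{\max}$ be its restriction to $\{u\in\ell^2(\mathbb N;\mathbb C^d):\mathcal Ju\in\ell^2(\mathbb N;\mathbb C^d)\}$, and let $J$ be any self-adjoint extension of $J_{\min}$ in $\ell^2(\mathbb N;\mathbb C^d)$. Let $\operatorname{ind}J_{\min}=\dim\ker(J_{\max}-zI)$, $\operatorname{Im}z\ne0$, denote the defect number of $J_{\min}$ (the bound below holds with every non-real $z$). Suppose that 1. for some $c\in\mathbb R$ and $N_0\in\mathbb N$ one has $B_{2n}\le cI$ for all $n\ge N_0$; 2. $\lim_{n\to\infty}B_{2n-1}=+\infty$,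 that is, for every $M\ge0$ there is $N$ such that $B_{2n-1}\ge MI$ for all $n\ge N$. Then the spectrum $\sigma(J)$ is discrete in $(c,+\infty)$, that is, every point of $\sigma(J)\cap(c,+\infty)$ is an isolated point of $\sigma(J)$ and an eigenvalue of $J$ of finite multiplicity; and $+\infty$ is the only accumulation point of $\sigma(J)\cap(c,+\infty)$ in $[-\infty,+\infty]$. Moreover, let $a>0$, let $N(c+a)\in\mathbb N$ be any number such that $B_{2n-1}\ge(c+a)I$ for all $n\ge N(c+a)$, and put $\mathcal N(c+a)=\max\{2N_0,\,2N(c+a)-1\}$. Then the number $n(J;(c,c+a))$ of eigenvalues of $J$ in $(c,c+a)$, counted with multiplicity, satisfies $$n(J;(c,c+a))\le d\cdot\mathcal N(c+a)+\operatorname{ind}J_{\min}.$$ There is no condition on the off-diagonal blocks $A_n$ other than invertibility. -/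

import Mathlib

open scoped MatrixOrder

noncomputable section

namespace BlockJacobi

/-- The space `ℂ^d` with its Euclidean norm. -/
abbrev Block (d : ℕ) : Type := EuclideanSpace ℂ (Fin d)

/-- The Hilbert space `ℓ²(ℕ; ℂ^d)`, where `ℕ = {1, 2, …}`. -/
abbrev L2 (d : ℕ) : Type := lp (fun _ : ℕ+ => Block d) 2

/-- The formal action of the block Jacobi matrix on an arbitrary sequence of vectors:
`(J u)_n = A_{n-1}^* u_{n-1} + B_n u_n + A_n u_{n+1}`, without the first term when `n = 1`. -/
def act {d : ℕ} (A B : ℕ+ → Matrix (Fin d) (Fin d) ℂ) :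
    (ℕ+ → Block d) →ₗ[ℂ] (ℕ+ → Block d) where
  toFun u n :=
    (if n = 1 then 0 else (A (n - 1)).conjTranspose.toEuclideanLin (u (n - 1)))
      + (B n).toEuclideanLin (u n) + (A n).toEuclideanLin (u (n + 1))
  map_add' u v := by
    funext n
    by_cases h : n = 1
    · simp only [h, if_true, Pi.add_apply, map_add]; abel
    · simp only [h, if_false, Pi.add_apply, map_add]; abel
  map_smul' a u := by
    funext n
    by_cases h : n = 1
    · simp only [h, if_true, Pi.smul_apply, map_smul, RingHom.id_apply, smul_add, smul_zero]
    · simp only [h, if_false, Pi.smul_apply, map_smul, RingHom.id_apply, smul_add]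

/-- The finite sequences: `u ∈ ℓ²(ℕ; ℂ^d)` with `u_j = 0` for all large `j`. -/
def finiteSeq (d : ℕ) : Submodule ℂ (L2 d) where
  carrier := {u | ∃ N : ℕ+, ∀ j, N ≤ j → u j = 0}
  zero_mem' := ⟨1, fun _ _ => rfl⟩
  add_mem' := by
    rintro u v ⟨N, hN⟩ ⟨M, hM⟩
    refine ⟨max N M, fun j hj => ?_⟩
    have h : (u + v) j = u j + v j := rfl
    rw [h, hN j (le_trans (le_max_left _ _) hj), hM j (le_trans (le_max_right _ _) hj), add_zero]
  smul_mem' := by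
    rintro a u ⟨N, hN⟩
    refine ⟨N, fun j hj => ?_⟩
    have h : (a • u) j = a • u j := rfl
    rw [h, hN j hj, smul_zero]

/-- The sequences `u ∈ ℓ²(ℕ; ℂ^d)` with `J u ∈ ℓ²(ℕ; ℂ^d)`. -/
def maxDomain {d : ℕ} (A B : ℕ+ → Matrix (Fin d) (Fin d) ℂ) : Submodule ℂ (L2 d) where
  carrier := {u | Memℓp (act A B u) 2}
  zero_mem' := by
    have h : act A B ((0 : L2 d) : ℕ+ → Block d) = 0 := map_zero (act A B)
    simp only [Set.mem_ofPred_eq, h]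
    exact zero_memℓp
  add_mem' := by
    intro u v hu hv
    have h : act A B ((u + v : L2 d) : ℕ+ → Block d) = act A B u + act A B v :=
      map_add (act A B) _ _
    simp only [Set.mem_ofPred_eq, h] at *
    exact hu.add hv
  smul_mem' := by
    intro a u hu
    have h : act A B ((a • u : L2 d) : ℕ+ → Block d) = a • act A B u :=
      map_smul (act A B) _ _
    simp only [Set.mem_ofPred_eq, h] at *
    exact hu.const_smul a

/-- The maximal operator `J_max`: the formal action on `{u ∈ ℓ² : J u ∈ ℓ²}`. -/
def Jmax {d : ℕ} (A B : ℕ+ → Matrix (Fin d) (Fin d) ℂ) : L2 d →ₗ.[ℂ] L2 d where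
  domain := maxDomain A B
  toFun :=
    { toFun := fun u => ⟨act A B (u : L2 d), u.2⟩
      map_add' := fun u v => Subtype.ext (map_add (act A B) ((u : L2 d) : ℕ+ → Block d) (v : L2 d))
      map_smul' := fun a u => Subtype.ext (map_smul (act A B) a ((u : L2 d) : ℕ+ → Block d)) }

theorem finiteSeq_le_maxDomain {d : ℕ} (A B : ℕ+ → Matrix (Fin d) (Fin d) ℂ) :
    finiteSeq d ≤ maxDomain A B := by
  rintro u ⟨N, hN⟩
  refine (memℓp_zero ?_).of_exponent_ge (zero_le)
  refine (Set.finite_Iic N).subset fun n hn => ?_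
  by_contra h
  have h' : N < n := not_le.mp h
  refine hn ?_
  have h1 : n ≠ 1 := fun h0 => absurd (one_le : 1 ≤ N) (not_le.mpr (h0 ▸ h'))
  have h2 : N ≤ n - 1 := by
    rw [← PNat.coe_le_coe, PNat.sub_coe, if_pos (one_lt_of_gt h')]
    have := PNat.coe_lt_coe N n |>.mpr h'
    simp only [PNat.one_coe]
    omega
  have h3 : N ≤ n + 1 := h'.le.trans (PNat.lt_add_right n 1).le
  simp only [act, LinearMap.coe_mk, AddHom.coe_mk, h1, if_false, hN _ h2, hN _ h'.le, hN _ h3,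
    map_zero, add_zero]

/-- The minimal operator `J_min`: the formal action on the finite sequences. -/
def Jmin {d : ℕ} (A B : ℕ+ → Matrix (Fin d) (Fin d) ℂ) : L2 d →ₗ.[ℂ] L2 d where
  domain := finiteSeq d
  toFun := (Jmax A B).toFun ∘ₗ Submodule.inclusion (finiteSeq_le_maxDomain A B)

/-- `lim C_n = +∞` for a sequence of Hermitian matrices, in the order of quadratic forms. -/
def TendsToInfinity {d : ℕ} (C : ℕ+ → Matrix (Fin d) (Fin d) ℂ) : Prop :=
  ∀ M : ℝ, 0 ≤ M → ∃ N : ℕ+, ∀ n, N ≤ n → (M : ℂ) • (1 : Matrix (Fin d) (Fin d) ℂ) ≤ C n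

section Operators

variable {H : Type*} [NormedAddCommGroup H] [InnerProductSpace ℂ H]

/-- `z` is in the resolvent set of the (possibly unbounded) operator `T`: the map
`T - z : dom T → H` is bijective with a bounded inverse `R`. -/
def InResolventSet (T : H →ₗ.[ℂ] H) (z : ℂ) : Prop :=
  ∃ R : H →L[ℂ] H,
    (∀ y : H, ∃ h : R y ∈ T.domain, T ⟨R y, h⟩ - z • R y = y) ∧
    (∀ x : T.domain, R (T x - z • (x : H)) = x)

/-- The spectrum of a (possibly unbounded) operator. -/
def spectrum (T : H →ₗ.[ℂ] H) : Set ℂ := {z | ¬ InResolventSet T z}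

/-- The kernel of `T - z`. -/
def eigenspace (T : H →ₗ.[ℂ] H) (z : ℂ) : Submodule ℂ H where
  carrier := {x | ∃ h : x ∈ T.domain, T ⟨x, h⟩ = z • x}
  zero_mem' := ⟨T.domain.zero_mem, by
    rw [smul_zero]; exact T.map_zero⟩
  add_mem' := by
    rintro x y ⟨hx, ex⟩ ⟨hy, ey⟩
    refine ⟨T.domain.add_mem hx hy, ?_⟩
    have h := T.map_add ⟨x, hx⟩ ⟨y, hy⟩
    rw [ex, ey, ← smul_add] at h
    exact h
  smul_mem' := by
    rintro a x ⟨hx, ex⟩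
    refine ⟨T.domain.smul_mem a hx, ?_⟩
    have h := T.map_smul a ⟨x, hx⟩
    rw [ex, smul_comm] at h
    exact h

/-- `dim ker (T - z)`, with value `⊤` in the infinite-dimensional case. -/
def mult (T : H →ₗ.[ℂ] H) (z : ℂ) : ℕ∞ :=
  Cardinal.toENat (Module.rank ℂ (eigenspace T z))

/-- The discrete spectrum: the isolated points of the spectrum that are eigenvalues of finite
multiplicity. -/
def discreteSpectrum (T : H →ₗ.[ℂ] H) : Set ℂ :=
  {z | z ∈ spectrum T ∧ ¬ AccPt z (Filter.principal (spectrum T)) ∧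
    eigenspace T z ≠ ⊥ ∧ FiniteDimensional ℂ (eigenspace T z)}

/-- The number of eigenvalues of `T` in the set `I ⊆ ℝ`, counted with multiplicity: the sum of
`dim ker (T - x)` over `x ∈ I`. -/
def eigenvalueCount (T : H →ₗ.[ℂ] H) (I : Set ℝ) : ℕ∞ :=
  ⨆ s : {s : Finset ℝ // (s : Set ℝ) ⊆ I}, ∑ x ∈ s.1, mult T (x : ℂ)

end Operators

/-- The defect number `dim ker (J_max - z)` of `J_min` at a non-real `z`. -/
def defectNumber {d : ℕ} (A B : ℕ+ → Matrix (Fin d) (Fin d) ℂ) (z : ℂ) : ℕ∞ :=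
  mult (Jmax A B) z

end BlockJacobi

end

/-! Number the blocks by k = 0, 1, … and pair (J - t)u with the sequence ((-1)^k u_k). In the real
part, the two terms coupling neighbouring blocks are conjugate and carry opposite signs, so they
cancel whatever the A_n are, and only the alternating diagonal survives
(`sum_alternating_inner_act`). For t = c + a/2 its far terms are at least (a/2)‖u_k‖²: at even k the
matrix is at least c + a, at odd k at most c. By Cauchy–Schwarz, (a/2)‖u‖ ≤ ‖(J - t)u‖ for finite u
vanishing on the first K blocks.

The domain of J exceeds that of the closure of J_min by finitely many dimensions. For non-real z,
the orthogonal complement of ran(J_min - z̄) lies in ker(J_max - z), so every u in dom J with (J -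
z̄)u orthogonal to this defect space is a graph limit of finite sequences
(`exists_tendsto_of_mem_orthogonal`). Hence the bound holds on the kernel of `boundaryMap`, whose
target has dimension dK + dim ker(J_max - z).

On the span of eigenvectors with eigenvalues in (c, c + a), ‖(J - t)u‖ < (a/2)‖u‖ unless u = 0, so
`boundaryMap` is injective there; this is the count (`eigenvalueCount_le_finrank`). The same bound
makes ran(J - t) closed, so spectrum above c consists of eigenvalues
(`inResolventSet_of_finite_codim`), finitely many below each real number. Were the spectrum bounded
above, so would be the form of J (`re_inner_le_of_forall_inResolventSet`), which vectors supported
on one odd-numbered block refute. -/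

noncomputable section

namespace BlockJacobi

/-! ### Unbounded self-adjoint operators: resolvents, closed range, eigenvalue counts. -/

section SelfAdjointOperators

open Filter Topology ComplexConjugate

variable {H : Type*} [NormedAddCommGroup H] [InnerProductSpace ℂ H]

/-- The map `T - z` on the domain of `T`. -/
def shift (T : H →ₗ.[ℂ] H) (z : ℂ) : T.domain →ₗ[ℂ] H := T.toFun - z • T.domain.subtype

theorem shift_apply (T : H →ₗ.[ℂ] H) (z : ℂ) (x : T.domain) :
    shift T z x = T x - z • (x : H) := rfl

theorem ker_shift_eq_bot {T : H →ₗ.[ℂ] H} {z : ℂ} (h : eigenspace T z = ⊥) :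
    LinearMap.ker (shift T z) = ⊥ := by
  rw [Submodule.eq_bot_iff]
  intro x hx
  rw [LinearMap.mem_ker, shift_apply, sub_eq_zero] at hx
  have : (x : H) ∈ eigenspace T z := ⟨x.2, hx⟩
  rw [h, Submodule.mem_bot] at this
  exact Subtype.ext this

theorem eigenspace_le_domain {T : H →ₗ.[ℂ] H} (z : ℂ) : eigenspace T z ≤ T.domain :=
  fun _ hx => hx.1

theorem norm_sum_sq_of_orthogonal {ι : Type*} [Fintype ι] (v : ι → H)
    (h : ∀ i j, i ≠ j → inner ℂ (v i) (v j) = 0) : ‖∑ i, v i‖ ^ 2 = ∑ i, ‖v i‖ ^ 2 := by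
  have : ((‖∑ i, v i‖ ^ 2 : ℝ) : ℂ) = ((∑ i, ‖v i‖ ^ 2 : ℝ) : ℂ) := by
    push_cast
    have e := inner_self_eq_norm_sq_to_K (𝕜 := ℂ) (∑ i, v i)
    simp only [Complex.coe_algebraMap] at e
    rw [← e, sum_inner]
    refine Finset.sum_congr rfl fun i _ => ?_
    rw [inner_sum, Finset.sum_eq_single i (fun j _ hj => h i j hj.symm) (by simp)]
    exact inner_self_eq_norm_sq_to_K (𝕜 := ℂ) (v i)
  exact_mod_cast this

variable [CompleteSpace H] {T : H →ₗ.[ℂ] H}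

theorem inner_map_comm (hT : IsSelfAdjoint T) (x y : T.domain) :
    inner ℂ (T x) (y : H) = inner ℂ (x : H) (T y) := by
  have h := LinearPMap.adjoint_isFormalAdjoint hT.dense_domain
  rw [LinearPMap.isSelfAdjoint_def.mp hT] at h
  exact h x y

theorem exists_mem_domain_of_inner (hT : IsSelfAdjoint T) {y w : H}
    (h : ∀ x : T.domain, inner ℂ w (x : H) = inner ℂ y (T x)) :
    ∃ hy : y ∈ T.domain, T ⟨y, hy⟩ = w := by
  have hy := LinearPMap.mem_adjoint_domain_of_exists y ⟨w, h⟩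
  have e := LinearPMap.adjoint_apply_eq hT.dense_domain ⟨y, hy⟩ h
  revert hy e
  rw [LinearPMap.isSelfAdjoint_def.mp hT]
  exact fun hy e => ⟨hy, e⟩

theorem exists_mem_domain_of_tendsto (hT : IsSelfAdjoint T) {u : ℕ → T.domain} {x y : H}
    (hu : Tendsto (fun k => (u k : H)) atTop (𝓝 x)) (hTu : Tendsto (fun k => T (u k)) atTop (𝓝 y)) :
    ∃ hx : x ∈ T.domain, T ⟨x, hx⟩ = y := by
  have h : (x, y) ∈ T.graph := by
    refine hT.isClosed.mem_of_tendsto (hu.prodMk_nhds hTu) (Eventually.of_forall fun k => ?_)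
    exact T.mem_graph (u k)
  obtain ⟨v, hv, hv'⟩ := (LinearPMap.mem_graph_iff T).mp h
  obtain rfl : (v : H) = x := hv
  exact ⟨v.2, hv'⟩

theorem im_inner_map_self (hT : IsSelfAdjoint T) (x : T.domain) :
    (inner ℂ (x : H) (T x)).im = 0 := by
  have h := inner_map_comm hT x x
  rw [← inner_conj_symm] at h
  exact Complex.conj_eq_iff_im.mp h

/-- Since ⟨x, Tx⟩ is real, the imaginary part of ⟨x, (T - z)x⟩ is -Im z ‖x‖²; Cauchy–Schwarz does
the rest. -/
theorem abs_im_mul_norm_le (hT : IsSelfAdjoint T) (z : ℂ) (x : T.domain) :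
    |z.im| * ‖(x : H)‖ ≤ ‖T x - z • (x : H)‖ := by
  have h1 : (inner ℂ (x : H) (T x - z • (x : H))).im = - z.im * ‖(x : H)‖ ^ 2 := by
    rw [inner_sub_right, inner_smul_right, Complex.sub_im, im_inner_map_self hT,
      inner_self_eq_norm_sq_to_K]
    simp only [Complex.mul_im, Complex.coe_algebraMap, ← Complex.ofReal_pow, Complex.ofReal_im,
      Complex.ofReal_re]
    ring
  have h2 : |z.im| * ‖(x : H)‖ ^ 2 ≤ ‖(x : H)‖ * ‖T x - z • (x : H)‖ := by
    refine le_trans ?_ (norm_inner_le_norm (𝕜 := ℂ) _ _)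
    refine le_trans (le_of_eq ?_) (Complex.abs_im_le_norm _)
    rw [h1, abs_mul, abs_neg, abs_of_nonneg (sq_nonneg ‖(x : H)‖)]
  rcases (norm_nonneg (x : H)).eq_or_lt with h | h
  · rw [← h, mul_zero]; exact norm_nonneg _
  · nlinarith

theorem eigenspace_eq_bot_of_im_ne_zero (hT : IsSelfAdjoint T) {z : ℂ} (hz : z.im ≠ 0) :
    eigenspace T z = ⊥ := by
  rw [Submodule.eq_bot_iff]
  rintro x ⟨hx, e⟩
  have h := abs_im_mul_norm_le hT z ⟨x, hx⟩
  rw [e, sub_self, norm_zero] at h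
  have := abs_pos.mpr hz
  exact norm_eq_zero.mp (le_antisymm (nonpos_of_mul_nonpos_right h this) (norm_nonneg _))

theorem orthogonal_range_shift (hT : IsSelfAdjoint T) (z : ℂ) :
    (LinearMap.range (shift T z))ᗮ ≤ eigenspace T (conj z) := by
  intro y hy
  rw [Submodule.mem_orthogonal'] at hy
  refine exists_mem_domain_of_inner hT fun x => ?_
  have h := hy _ (LinearMap.mem_range_self _ x)
  rw [shift_apply, inner_sub_right, sub_eq_zero, inner_smul_right] at h
  rw [inner_smul_left, Complex.conj_conj, h]

/-- The lower bound turns a convergent sequence of images into a Cauchy sequence of preimages, and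
the graph of T is closed. The hypothesis `hD` says that `D` is closed in the graph norm. -/
theorem isClosed_map_shift (hT : IsSelfAdjoint T) {z : ℂ} {δ : ℝ} (hδ : 0 < δ)
    (D : Submodule ℂ T.domain)
    (hD : ∀ (u : ℕ → T.domain) (x : T.domain), (∀ k, u k ∈ D) →
      Tendsto (fun k => (u k : H)) atTop (𝓝 x) → Tendsto (fun k => T (u k)) atTop (𝓝 (T x)) → x ∈ D)
    (hb : ∀ u ∈ D, δ * ‖(u : H)‖ ≤ ‖T u - z • (u : H)‖) :
    IsClosed (D.map (shift T z) : Set H) := by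
  refine IsSeqClosed.isClosed fun y w hy hw => ?_
  choose u huD hu using hy
  have hc : CauchySeq fun k => (u k : H) := by
    rw [Metric.cauchySeq_iff]
    intro ε hε
    obtain ⟨N, hN⟩ := Metric.cauchySeq_iff.mp hw.cauchySeq (δ * ε) (by positivity)
    refine ⟨N, fun m hm n hn => ?_⟩
    have h1 := hN m hm n hn
    have h2 := hb (u m - u n) (D.sub_mem (huD m) (huD n))
    rw [← shift_apply, map_sub, hu, hu, ← dist_eq_norm, Submodule.coe_sub, ← dist_eq_norm] at h2
    exact lt_of_mul_lt_mul_left (h2.trans_lt h1) hδ.le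
  obtain ⟨x, hx⟩ := cauchySeq_tendsto_of_complete hc
  have hTu : Tendsto (fun k => T (u k)) atTop (𝓝 (w + z • x)) := by
    refine (hw.add (hx.const_smul z)).congr fun k => ?_
    rw [← hu k, shift_apply, sub_add_cancel]
  obtain ⟨hxd, hTx⟩ := exists_mem_domain_of_tendsto hT hx hTu
  refine ⟨⟨x, hxd⟩, hD u ⟨x, hxd⟩ huD hx (hTx ▸ hTu), ?_⟩
  rw [shift_apply, hTx, add_sub_cancel_right]

/-- The inverse is bounded by the closed graph theorem. -/
theorem inResolventSet_of_bijective (hT : IsSelfAdjoint T) {z : ℂ}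
    (h : Function.Bijective (shift T z)) : InResolventSet T z := by
  let e := LinearEquiv.ofBijective (shift T z) h
  have he : ∀ y, T (e.symm y) - z • (e.symm y : H) = y := fun y => e.apply_symm_apply y
  let R : H →ₗ[ℂ] H := T.domain.subtype ∘ₗ e.symm.toLinearMap
  have hR : Continuous R := by
    refine R.continuous_of_seq_closed_graph fun y x w hy hRy => ?_
    have h1 : Tendsto (fun k => T (e.symm (y k))) atTop (𝓝 (x + z • w)) := by
      refine (hy.add (hRy.const_smul z)).congr fun k => ?_
      have := he (y k)
      rw [sub_eq_iff_eq_add] at this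
      rw [this]
      rfl
    obtain ⟨hw, hTw⟩ := exists_mem_domain_of_tendsto hT hRy h1
    have h2 : e ⟨w, hw⟩ = x := by
      change T ⟨w, hw⟩ - z • w = x
      rw [hTw, add_sub_cancel_right]
    change w = e.symm x
    rw [← h2, e.symm_apply_apply]
  refine ⟨⟨R, hR⟩, fun y => ⟨(e.symm y).2, he y⟩, fun x => ?_⟩
  exact congrArg Subtype.val (e.symm_apply_apply x)

/-- If `T - z` and `T - conj z` are injective and `T - z` is bounded below on a graph-closed subspace
of finite codimension in the domain, then `z` is in the resolvent set. -/
theorem inResolventSet_of_finite_codim (hT : IsSelfAdjoint T) {z : ℂ} {δ : ℝ} (hδ : 0 < δ)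
    {V : Type*} [AddCommGroup V] [Module ℂ V] [FiniteDimensional ℂ V] (F : T.domain →ₗ[ℂ] V)
    (hF : ∀ (u : ℕ → T.domain) (x : T.domain), (∀ k, F (u k) = 0) →
      Tendsto (fun k => (u k : H)) atTop (𝓝 x) → Tendsto (fun k => T (u k)) atTop (𝓝 (T x)) →
      F x = 0)
    (hb : ∀ u, F u = 0 → δ * ‖(u : H)‖ ≤ ‖T u - z • (u : H)‖)
    (hz : eigenspace T z = ⊥) (hz' : eigenspace T (conj z) = ⊥) : InResolventSet T z := by
  have hinj : Function.Injective (shift T z) := LinearMap.ker_eq_bot.mp (ker_shift_eq_bot hz)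
  refine inResolventSet_of_bijective hT ⟨hinj, LinearMap.range_eq_top.mp ?_⟩
  obtain ⟨Q, hQ⟩ := (LinearMap.ker F).exists_isCompl
  have hQf : FiniteDimensional ℂ Q := by
    refine FiniteDimensional.of_injective (F ∘ₗ Q.subtype) ?_
    rw [← LinearMap.ker_eq_bot, Submodule.eq_bot_iff]
    intro x hx
    exact Subtype.ext (Submodule.disjoint_def.mp hQ.disjoint x hx x.2)
  -- The range is the image of `ker F`, closed by the lower bound, plus the finite-dimensional image
  -- of the complement `Q`.
  have hcl : IsClosed (LinearMap.range (shift T z) : Set H) := by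
    rw [LinearMap.range_eq_map, ← hQ.sup_eq_top, Submodule.map_sup]
    have : FiniteDimensional ℂ (Q.map (shift T z)) := inferInstance
    exact Submodule.isClosed_sup_finiteDimensional _ _
      (isClosed_map_shift hT hδ (LinearMap.ker F) hF hb)
  have ho : (LinearMap.range (shift T z))ᗮ = ⊥ :=
    le_bot_iff.mp ((orthogonal_range_shift hT z).trans hz'.le)
  rw [← hcl.submodule_topologicalClosure_eq, Submodule.topologicalClosure_eq_top_iff, ho]

theorem inResolventSet_of_im_ne_zero (hT : IsSelfAdjoint T) {z : ℂ} (hz : z.im ≠ 0) :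
    InResolventSet T z := by
  refine inResolventSet_of_finite_codim hT (abs_pos.mpr hz) (0 : T.domain →ₗ[ℂ] ℂ)
    (fun _ _ _ _ _ => rfl) (fun u _ => abs_im_mul_norm_le hT z u)
    (eigenspace_eq_bot_of_im_ne_zero hT hz)
    (eigenspace_eq_bot_of_im_ne_zero hT (by rwa [Complex.conj_im, neg_ne_zero]))

theorem inner_eigenspace (hT : IsSelfAdjoint T) {s t : ℝ} (hst : s ≠ t) {x y : H}
    (hx : x ∈ eigenspace T s) (hy : y ∈ eigenspace T t) : inner ℂ x y = 0 := by
  obtain ⟨hx, ex⟩ := hx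
  obtain ⟨hy, ey⟩ := hy
  have h := inner_map_comm hT ⟨x, hx⟩ ⟨y, hy⟩
  rw [ex, ey, inner_smul_left, inner_smul_right, Complex.conj_ofReal, ← sub_eq_zero,
    ← sub_mul, mul_eq_zero, sub_eq_zero, Complex.ofReal_inj] at h
  exact h.resolve_left hst

/-- If `δ ‖u‖ ≤ ‖(T - t) u‖` on the kernel of a linear map `F` from the domain of `T` to `V`, then
`T` has at most `dim V` eigenvalues in `(t - δ, t + δ)`. -/
theorem eigenvalueCount_le_finrank (hT : IsSelfAdjoint T) {t δ : ℝ}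
    {V : Type*} [AddCommGroup V] [Module ℂ V] [FiniteDimensional ℂ V] (F : T.domain →ₗ[ℂ] V)
    (hb : ∀ u, F u = 0 → δ * ‖(u : H)‖ ≤ ‖T u - (t : ℂ) • (u : H)‖) :
    eigenvalueCount T (Set.Ioo (t - δ) (t + δ)) ≤ (Module.finrank ℂ V : ℕ∞) := by
  refine iSup_le ?_
  rintro ⟨s, hs⟩
  change ∑ x ∈ s, mult T (x : ℂ) ≤ _
  let E : s → Submodule ℂ H := fun x => eigenspace T ((x : ℝ) : ℂ)
  let G : (∀ x, E x) →ₗ[ℂ] T.domain :=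
    ∑ x, Submodule.inclusion (eigenspace_le_domain _) ∘ₗ LinearMap.proj x
  have hG : ∀ w, (G w : H) = ∑ x, (w x : H) := by
    intro w
    simp only [G, LinearMap.coe_sum, Finset.sum_apply, LinearMap.comp_apply, LinearMap.proj_apply,
      Submodule.coe_sum, Submodule.coe_inclusion]
  have hTG : ∀ w, T (G w) = ∑ x : s, ((x : ℝ) : ℂ) • (w x : H) := by
    intro w
    change T.toFun (G w) = _
    simp only [G, LinearMap.coe_sum, Finset.sum_apply, LinearMap.comp_apply, LinearMap.proj_apply,
      map_sum]
    exact Finset.sum_congr rfl fun x _ => (w x).2.2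
  have horth : ∀ (w : ∀ x, E x) (i j : s), i ≠ j → inner ℂ (w i : H) (w j : H) = 0 :=
    fun w i j hij => inner_eigenspace hT (fun h => hij (Subtype.ext h)) (w i).2 (w j).2
  have hinj : Function.Injective (F ∘ₗ G) := by
    rw [← LinearMap.ker_eq_bot, Submodule.eq_bot_iff]
    intro w hw
    have h1 := hb (G w) hw
    have h2 : T (G w) - (t : ℂ) • (G w : H) = ∑ x : s, (((x : ℝ) - t : ℝ) : ℂ) • (w x : H) := by
      rw [hTG, hG, Finset.smul_sum, ← Finset.sum_sub_distrib]
      refine Finset.sum_congr rfl fun x _ => ?_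
      rw [← sub_smul, Complex.ofReal_sub]
    by_contra hne
    obtain ⟨x₀, hx₀⟩ : ∃ x, w x ≠ 0 := by
      by_contra! h
      exact hne (funext h)
    -- The interval contains `x₀`, so it is nonempty.
    have hδ : 0 < δ := by
      have := hs x₀.2
      linarith [this.1, this.2]
    have h3 : (δ * ‖(G w : H)‖) ^ 2 ≤ ‖T (G w) - (t : ℂ) • (G w : H)‖ ^ 2 :=
      pow_le_pow_left₀ (by positivity) h1 2
    rw [h2, mul_pow, hG, norm_sum_sq_of_orthogonal _ (horth w), norm_sum_sq_of_orthogonal _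
      (fun i j hij => by rw [inner_smul_left, inner_smul_right, horth w i j hij, mul_zero, mul_zero]),
      Finset.mul_sum] at h3
    -- By Pythagoras both sides are sums over the eigenvalues; |x - t| < δ termwise, and the
    -- component at `x₀` makes the inequality strict.
    refine absurd h3 (not_le.mpr (Finset.sum_lt_sum (fun x _ => ?_) ⟨x₀, Finset.mem_univ _, ?_⟩))
    · have hx := hs x.2
      rw [norm_smul, mul_pow, Complex.norm_real, Real.norm_eq_abs, sq_abs]
      refine mul_le_mul_of_nonneg_right ?_ (sq_nonneg _)
      nlinarith [hx.1, hx.2]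
    · have hx := hs x₀.2
      rw [norm_smul, mul_pow, Complex.norm_real, Real.norm_eq_abs, sq_abs]
      have : 0 < ‖(w x₀ : H)‖ := norm_pos_iff.mpr fun h => hx₀ (Subtype.ext h)
      refine mul_lt_mul_of_pos_right ?_ (by positivity)
      nlinarith [hx.1, hx.2]
  have hfin : ∀ x, FiniteDimensional ℂ (E x) := fun x =>
    FiniteDimensional.of_injective ((F ∘ₗ G) ∘ₗ LinearMap.single ℂ (fun x => E x) x)
      (hinj.comp fun a b h => by simpa using congrFun h x)
  have hle := LinearMap.finrank_le_finrank_of_injective hinj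
  rw [Module.finrank_pi_fintype] at hle
  rw [← Finset.sum_coe_sort]
  have hm : ∀ x : s, mult T ((x : ℝ) : ℂ) = (Module.finrank ℂ (E x) : ℕ∞) := fun x => by
    have := hfin x
    rw [mult, ← Module.finrank_eq_rank, Cardinal.toENat_nat]
  simp only [hm]
  exact_mod_cast hle

/-- The resolvent R at t is bounded and self-adjoint, and resolvents to the right of t show that -R
has no negative spectrum. Thus -R ≥ 0, and evaluating its form at (T - t)u gives the claim. -/
theorem re_inner_le_of_forall_inResolventSet (hT : IsSelfAdjoint T) {M : ℝ}
    (hM : ∀ x : ℝ, M < x → InResolventSet T x) {t : ℝ} (ht : M < t) (u : T.domain) :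
    (inner ℂ (T u) (u : H)).re ≤ t * ‖(u : H)‖ ^ 2 := by
  obtain ⟨R, hR, hR'⟩ := hM t ht
  have hsymm : ∀ x y, inner ℂ (R x) y = inner ℂ x (R y) := by
    intro x y
    obtain ⟨hx, ex⟩ := hR x
    obtain ⟨hy, ey⟩ := hR y
    have h := inner_map_comm hT ⟨R x, hx⟩ ⟨R y, hy⟩
    conv_lhs => rw [← ey]
    conv_rhs => rw [← ex]
    rw [inner_sub_right, inner_sub_left, h, inner_smul_left, inner_smul_right, Complex.conj_ofReal]
  have hsa : IsSelfAdjoint R := by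
    rw [ContinuousLinearMap.isSelfAdjoint_iff_isSymmetric]
    exact hsymm
  have hspec : ∀ μ ∈ _root_.spectrum ℝ (-R), 0 ≤ μ := by
    intro μ hμ
    by_contra! hneg
    refine hμ ?_
    -- 1/(s - t) = -μ at s = t - 1/μ, which exceeds t as μ < 0. The resolvent identity RW = WR = μ(R
    -- - W) then yields the inverse μ⁻¹(1 - μ⁻¹W) of μ + R.
    obtain ⟨W, hW, hW'⟩ := hM (t - 1 / μ) (by have := one_div_neg.mpr hneg; linarith)
    have hμ' : (μ : ℂ) ≠ 0 := by exact_mod_cast hneg.ne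
    have k1 : ∀ x, R (W x) = (μ : ℂ) • (R x - W x) := by
      intro x
      obtain ⟨hx, ex⟩ := hW x
      have h := hR' ⟨W x, hx⟩
      have e : T ⟨W x, hx⟩ - (t : ℂ) • W x = x - (1 / μ : ℂ) • W x := by
        rw [sub_eq_iff_eq_add] at ex
        rw [ex]
        push_cast
        module
      rw [e, map_sub, map_smul] at h
      change R x - (1 / μ : ℂ) • R (W x) = W x at h
      rw [sub_eq_of_eq_add' (sub_eq_iff_eq_add.mp h), smul_smul, mul_one_div_cancel hμ', one_smul]
    have k2 : ∀ x, W (R x) = (μ : ℂ) • (R x - W x) := by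
      intro x
      obtain ⟨hx, ex⟩ := hR x
      have h := hW' ⟨R x, hx⟩
      have e : T ⟨R x, hx⟩ - ((t - 1 / μ : ℝ) : ℂ) • R x = x + (1 / μ : ℂ) • R x := by
        rw [sub_eq_iff_eq_add] at ex
        rw [ex]
        push_cast
        module
      rw [e, map_add, map_smul] at h
      change W x + (1 / μ : ℂ) • W (R x) = R x at h
      rw [sub_eq_of_eq_add' h.symm, smul_smul, mul_one_div_cancel hμ', one_smul]
    have e0 : algebraMap ℝ (H →L[ℂ] H) μ = (μ : ℂ) • 1 := by
      rw [Algebra.algebraMap_eq_smul_one]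
      ext x
      simp
    have m1 : (algebraMap ℝ (H →L[ℂ] H) μ - -R) * ((1 / μ : ℂ) • (1 - (1 / μ : ℂ) • W)) = 1 := by
      rw [e0]
      ext x
      simp only [mul_apply_eq_comp, sub_apply,
        smul_apply, one_apply_eq_self,
        neg_apply, map_smul, map_sub]
      rw [k1]
      match_scalars <;> field_simp <;> ring_nf
    have m2 : ((1 / μ : ℂ) • (1 - (1 / μ : ℂ) • W)) * (algebraMap ℝ (H →L[ℂ] H) μ - -R) = 1 := by
      rw [e0]
      ext x
      simp only [mul_apply_eq_comp, sub_apply,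
        smul_apply, one_apply_eq_self,
        neg_apply, map_smul, map_sub, map_neg]
      rw [k2]
      match_scalars <;> field_simp <;> ring_nf
    exact ⟨⟨_, _, m1, m2⟩, rfl⟩
  have hpos : 0 ≤ -R :=
    (StarOrderedRing.nonneg_iff_spectrum_nonneg (R := ℝ) (-R) hsa.neg).mpr hspec
  rw [ContinuousLinearMap.nonneg_iff_isPositive] at hpos
  have h := hpos.re_inner_nonneg_left (T u - (t : ℂ) • (u : H))
  rw [neg_apply, hR', inner_neg_left, inner_sub_right, inner_smul_right,
    inner_self_eq_norm_sq_to_K] at h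
  rw [inner_map_comm hT]
  simp only [Complex.coe_algebraMap, map_neg, map_sub, RCLike.re_to_complex, ← Complex.ofReal_pow,
    Complex.re_ofReal_mul, Complex.ofReal_re] at h
  linarith

end SelfAdjointOperators

/-! ### Summation identities for block Jacobi matrices, and the defect space. -/

section JacobiMatrices

open Filter Topology ComplexConjugate

variable {d : ℕ} {A B : ℕ+ → Matrix (Fin d) (Fin d) ℂ}

theorem act_succPNat_zero (u : ℕ+ → Block d) :
    act A B u (Nat.succPNat 0) = (B (Nat.succPNat 0)).toEuclideanLin (u (Nat.succPNat 0))
      + (A (Nat.succPNat 0)).toEuclideanLin (u (Nat.succPNat 1)) := by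
  change (if (1 : ℕ+) = 1 then (0 : Block d) else _) + _ + _ = _
  rw [if_pos rfl, zero_add]
  rfl

theorem act_succPNat_succ (u : ℕ+ → Block d) (k : ℕ) :
    act A B u (Nat.succPNat (k + 1)) =
      (A (Nat.succPNat k)).conjTranspose.toEuclideanLin (u (Nat.succPNat k))
      + (B (Nat.succPNat (k + 1))).toEuclideanLin (u (Nat.succPNat (k + 1)))
      + (A (Nat.succPNat (k + 1))).toEuclideanLin (u (Nat.succPNat (k + 2))) := by
  have h1 : Nat.succPNat (k + 1) ≠ 1 := fun h => absurd (congrArg PNat.val h) (by simp)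
  have h2 : Nat.succPNat (k + 1) - 1 = Nat.succPNat k := by
    have h3 : (1 : ℕ+) < Nat.succPNat (k + 1) := lt_of_le_of_ne one_le h1.symm
    apply PNat.eq
    rw [PNat.sub_coe, if_pos h3, Nat.succPNat_coe, Nat.succPNat_coe, PNat.one_coe]
    rfl
  change (if Nat.succPNat (k + 1) = 1 then (0 : Block d) else _) + _ + _ = _
  rw [if_neg h1, h2]
  rfl

theorem inner_toEuclideanLin_conjTranspose (M : Matrix (Fin d) (Fin d) ℂ) (x y : Block d) :
    inner ℂ (M.conjTranspose.toEuclideanLin x) y = inner ℂ x (M.toEuclideanLin y) := by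
  rw [Matrix.toEuclideanLin_conjTranspose_eq_adjoint, LinearMap.adjoint_inner_left]

theorem inner_toEuclideanLin_left (M : Matrix (Fin d) (Fin d) ℂ) (x y : Block d) :
    inner ℂ (M.toEuclideanLin x) y = inner ℂ x (M.conjTranspose.toEuclideanLin y) := by
  rw [← inner_toEuclideanLin_conjTranspose, Matrix.conjTranspose_conjTranspose]

theorem inner_toEuclideanLin_of_isHermitian {M : Matrix (Fin d) (Fin d) ℂ} (hM : M.IsHermitian)
    (x y : Block d) : inner ℂ (M.toEuclideanLin x) y = inner ℂ x (M.toEuclideanLin y) := by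
  rw [inner_toEuclideanLin_left, hM.eq]

theorem re_inner_toEuclideanLin_mono {M M' : Matrix (Fin d) (Fin d) ℂ} (h : M ≤ M')
    (x : Block d) : (inner ℂ (M.toEuclideanLin x) x).re ≤ (inner ℂ (M'.toEuclideanLin x) x).re := by
  have h1 := Matrix.isPositive_toEuclideanLin_iff.mpr (Matrix.le_iff.mp h)
  have h2 := h1.2 x
  rw [map_sub, LinearMap.sub_apply, inner_sub_left, map_sub, sub_nonneg] at h2
  exact h2

theorem re_inner_toEuclideanLin_smul_one (r : ℝ) (x : Block d) :
    (inner ℂ (((r : ℂ) • (1 : Matrix (Fin d) (Fin d) ℂ)).toEuclideanLin x) x).re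
      = r * ‖x‖ ^ 2 := by
  have : ((r : ℂ) • (1 : Matrix (Fin d) (Fin d) ℂ)).toEuclideanLin x = (r : ℂ) • x := by
    rw [map_smul, LinearMap.smul_apply, Matrix.toLpLin_apply, Matrix.one_mulVec]
  rw [this, inner_smul_left, Complex.conj_ofReal, inner_self_eq_norm_sq_to_K]
  simp [← Complex.ofReal_pow]

/-- The alternating quadratic form of `J` is diagonal up to a boundary term. -/
theorem sum_alternating_inner_act (u : ℕ+ → Block d) (m : ℕ) :
    ∑ k ∈ Finset.range (m + 1),
        (-1 : ℝ) ^ k * (inner ℂ (act A B u k.succPNat) (u k.succPNat)).re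
      = ∑ k ∈ Finset.range (m + 1),
          (-1 : ℝ) ^ k * (inner ℂ ((B k.succPNat).toEuclideanLin (u k.succPNat)) (u k.succPNat)).re
        + (-1 : ℝ) ^ m * (inner ℂ ((A m.succPNat).toEuclideanLin (u (m + 1).succPNat))
            (u m.succPNat)).re := by
  induction m with
  | zero =>
    simp only [Finset.sum_range_one, pow_zero, one_mul, act_succPNat_zero, inner_add_left,
      Complex.add_re, zero_add]
  | succ m ih =>
    -- The new term with A_m^* is the conjugate of the old boundary term with the opposite sign, so
    -- the real parts cancel.
    rw [Finset.sum_range_succ, ih, Finset.sum_range_succ _ (m + 1), act_succPNat_succ,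
      inner_add_left, inner_add_left, inner_toEuclideanLin_conjTranspose, Complex.add_re,
      Complex.add_re, ← inner_conj_symm (u m.succPNat), Complex.conj_re]
    ring

/-- The discrete Green identity. -/
theorem sum_inner_act_sub (hB : ∀ n, (B n).IsHermitian) (u v : ℕ+ → Block d) (m : ℕ) :
    ∑ k ∈ Finset.range (m + 1), inner ℂ (act A B u k.succPNat) (v k.succPNat)
      + inner ℂ (u m.succPNat) ((A m.succPNat).toEuclideanLin (v (m + 1).succPNat))
    = ∑ k ∈ Finset.range (m + 1), inner ℂ (u k.succPNat) (act A B v k.succPNat)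
      + inner ℂ ((A m.succPNat).toEuclideanLin (u (m + 1).succPNat)) (v m.succPNat) := by
  induction m with
  | zero =>
    simp only [Finset.sum_range_one, act_succPNat_zero, inner_add_left, inner_add_right,
      inner_toEuclideanLin_of_isHermitian (hB _), zero_add]
    ring
  | succ m ih =>
    rw [Finset.sum_range_succ, Finset.sum_range_succ _ (m + 1), act_succPNat_succ,
      act_succPNat_succ, inner_add_left, inner_add_left, inner_add_right, inner_add_right,
      inner_toEuclideanLin_conjTranspose, inner_toEuclideanLin_of_isHermitian (hB _),
      ← inner_toEuclideanLin_left]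
    linear_combination ih

theorem hasSum_inner_succPNat (f g : L2 d) :
    HasSum (fun k : ℕ => inner ℂ (f k.succPNat) (g k.succPNat)) (inner ℂ f g) :=
  (Equiv.hasSum_iff Equiv.pnatEquivNat.symm
    (f := fun n : ℕ+ => (inner ℂ (f n) (g n) : ℂ))).mpr (lp.hasSum_inner f g)

theorem inner_eq_sum_range {f g : L2 d} {m : ℕ}
    (h : ∀ k, m ≤ k → inner ℂ (f k.succPNat) (g k.succPNat) = 0) :
    inner ℂ f g = ∑ k ∈ Finset.range m, inner ℂ (f k.succPNat) (g k.succPNat) :=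
  (hasSum_inner_succPNat f g).unique
    (hasSum_sum_of_ne_finset_zero fun k hk => h k (not_lt.mp fun h' => hk (Finset.mem_range.mpr h')))

theorem hasSum_norm_sq_succPNat (f : L2 d) :
    HasSum (fun k : ℕ => ‖f k.succPNat‖ ^ 2) (‖f‖ ^ 2) := by
  have h := lp.hasSum_norm (p := 2) (by norm_num) f
  norm_num at h
  exact (Equiv.hasSum_iff Equiv.pnatEquivNat.symm (f := fun n : ℕ+ => ‖f n‖ ^ 2)).mpr h

theorem sum_norm_mul_norm_le (f g : L2 d) (s : Finset ℕ) :
    ∑ k ∈ s, ‖f k.succPNat‖ * ‖g k.succPNat‖ ≤ ‖f‖ * ‖g‖ := by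
  refine abs_le_of_sq_le_sq' ?_ (by positivity) |>.2
  refine (Finset.sum_mul_sq_le_sq_mul_sq _ _ _).trans ?_
  rw [mul_pow]
  gcongr
  · exact sum_le_hasSum _ (fun _ _ => sq_nonneg _) (hasSum_norm_sq_succPNat f)
  · exact sum_le_hasSum _ (fun _ _ => sq_nonneg _) (hasSum_norm_sq_succPNat g)

theorem exists_eq_zero_of_mem_finiteSeq {v : L2 d} (hv : v ∈ finiteSeq d) :
    ∃ m : ℕ, ∀ k, m ≤ k → v k.succPNat = 0 := by
  obtain ⟨N, hN⟩ := hv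
  refine ⟨N, fun k hk => hN _ ?_⟩
  rw [← PNat.coe_le_coe, Nat.succPNat_coe]
  omega

theorem Jmin_apply (v : (Jmin A B).domain) (n : ℕ+) : (Jmin A B v) n = act A B (v : L2 d) n := rfl

/-- The lower bound for `J - t` on finite sequences: up to the first `K` blocks, it is bounded
below by the constant in the bound for the alternating diagonal. -/
theorem norm_Jmin_sub_lower_bound {t δ : ℝ} {K : ℕ}
    (hK : ∀ k, K ≤ k → ∀ x : Block d, δ * ‖x‖ ^ 2 ≤
      (-1 : ℝ) ^ k * ((inner ℂ ((B k.succPNat).toEuclideanLin x) x).re - t * ‖x‖ ^ 2))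
    (v : (Jmin A B).domain) :
    δ * ‖(v : L2 d)‖ ^ 2 + ∑ k ∈ Finset.range K,
      ((-1 : ℝ) ^ k * ((inner ℂ ((B k.succPNat).toEuclideanLin ((v : L2 d) k.succPNat))
        ((v : L2 d) k.succPNat)).re - t * ‖(v : L2 d) k.succPNat‖ ^ 2)
        - δ * ‖(v : L2 d) k.succPNat‖ ^ 2)
    ≤ ‖Jmin A B v - (t : ℂ) • (v : L2 d)‖ * ‖(v : L2 d)‖ := by
  obtain ⟨m, hm⟩ := exists_eq_zero_of_mem_finiteSeq v.2
  set w : L2 d := (v : L2 d) with hw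
  set M := max m K with hM
  have hv : ∀ k, M ≤ k → w k.succPNat = 0 := fun k hk => hm k ((le_max_left _ _).trans hk)
  have h1 : ‖w‖ ^ 2 = ∑ k ∈ Finset.range (M + 1), ‖w k.succPNat‖ ^ 2 :=
    (hasSum_norm_sq_succPNat w).unique (hasSum_sum_of_ne_finset_zero fun k hk => by
      rw [hv k (by rw [Finset.mem_range] at hk; omega), norm_zero, zero_pow two_ne_zero])
  have h2 := sum_alternating_inner_act (A := A) (B := B) w M
  rw [hv (M + 1) (by omega), map_zero, inner_zero_left, Complex.zero_re, mul_zero, add_zero] at h2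
  have h3 : ∀ k : ℕ, (inner ℂ ((Jmin A B v - (t : ℂ) • w : L2 d) k.succPNat) (w k.succPNat)).re
      = (inner ℂ (act A B w k.succPNat) (w k.succPNat)).re - t * ‖w k.succPNat‖ ^ 2 := by
    intro k
    change (inner ℂ (act A B w k.succPNat - (t : ℂ) • w k.succPNat) (w k.succPNat)).re = _
    rw [inner_sub_left, inner_smul_left, Complex.conj_ofReal, inner_self_eq_norm_sq_to_K]
    simp [← Complex.ofReal_pow]
  calc
    _ ≤ ∑ k ∈ Finset.range (M + 1), (-1 : ℝ) ^ k *
        ((inner ℂ ((B k.succPNat).toEuclideanLin (w k.succPNat)) (w k.succPNat)).re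
          - t * ‖w k.succPNat‖ ^ 2) := by
      -- After subtracting δ‖w‖², the terms with index at least `K` are nonnegative by `hK` and may
      -- be dropped.
      rw [← le_sub_iff_add_le', h1, Finset.mul_sum, ← Finset.sum_sub_distrib]
      refine Finset.sum_le_sum_of_subset_of_nonneg
        (Finset.range_subset_range.mpr (by omega)) fun k _ hk => ?_
      exact sub_nonneg.mpr (hK k (by simpa using hk) _)
    _ = ∑ k ∈ Finset.range (M + 1), (-1 : ℝ) ^ k *
        (inner ℂ ((Jmin A B v - (t : ℂ) • w : L2 d) k.succPNat) (w k.succPNat)).re := by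
      simp only [h3, mul_sub, Finset.sum_sub_distrib, h2]
    _ ≤ ∑ k ∈ Finset.range (M + 1),
        ‖(Jmin A B v - (t : ℂ) • w : L2 d) k.succPNat‖ * ‖w k.succPNat‖ := by
      refine Finset.sum_le_sum fun k _ => ?_
      refine (le_abs_self _).trans ?_
      rw [abs_mul, abs_pow, abs_neg, abs_one, one_pow, one_mul]
      exact (Complex.abs_re_le_norm _).trans (norm_inner_le_norm _ _)
    _ ≤ _ := sum_norm_mul_norm_le _ _ _

theorem single_apply_of_ne {n j : ℕ+} (e : Block d) (h : j ≠ n) :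
    (lp.single 2 n e : L2 d) j = 0 := Pi.single_eq_of_ne h _

theorem single_mem_finiteSeq (n : ℕ+) (e : Block d) : lp.single 2 n e ∈ finiteSeq d :=
  ⟨n + 1, fun _ hj => single_apply_of_ne e ((PNat.lt_add_right n 1).trans_le hj).ne'⟩

/-- The formal action is a formal adjoint of `J_min`, without any assumption on the second
sequence. -/
theorem inner_Jmin_single (hB : ∀ n, (B n).IsHermitian) (n : ℕ+) (e : Block d) (y : L2 d) :
    inner ℂ (Jmin A B ⟨lp.single 2 n e, single_mem_finiteSeq n e⟩) y
      = inner ℂ e (act A B y n) := by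
  obtain ⟨v, hv⟩ : ∃ v : (Jmin A B).domain, v = ⟨lp.single 2 n e, single_mem_finiteSeq n e⟩ :=
    ⟨_, rfl⟩
  rw [← hv]
  obtain ⟨k, rfl⟩ : ∃ k : ℕ, n = k.succPNat := ⟨n.natPred, by simp⟩
  have hz : ∀ j, j ≠ k → (v : L2 d) (Nat.succPNat j) = 0 := fun j hj => by
    rw [hv]
    exact single_apply_of_ne e fun h => hj (Nat.succPNat_injective h)
  have hk : (v : L2 d) k.succPNat = e := by
    rw [hv]
    exact Pi.single_eq_same _ _
  -- The image of a vector supported on block k reaches block k + 1 at most; cutting there keeps all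
  -- of it, and the boundary terms vanish.
  have h := sum_inner_act_sub (A := A) hB (v : L2 d) y (k + 1)
  rw [hz (k + 1) (by omega), hz (k + 1 + 1) (by omega), map_zero, inner_zero_left, inner_zero_left,
    add_zero, add_zero] at h
  rw [inner_eq_sum_range (m := k + 1 + 1)]
  · simp only [Jmin_apply]
    rw [h, Finset.sum_eq_single k, hk]
    · intro j _ hj
      rw [hz j hj, inner_zero_left]
    · simp
  · intro j hj
    obtain ⟨i, rfl⟩ : ∃ i, j = i + 1 := ⟨j - 1, by omega⟩
    rw [Jmin_apply, act_succPNat_succ, hz i (by omega), hz (i + 1) (by omega),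
      hz (i + 2) (by omega)]
    simp

/-- Testing orthogonality against vectors supported on one block gives the equation (𝒥y)_n = z y_n
block by block; then 𝒥y = zy is square-summable. -/
theorem orthogonal_range_shift_Jmin_le (hB : ∀ n, (B n).IsHermitian) (z : ℂ) :
    (LinearMap.range (shift (Jmin A B) (conj z)))ᗮ ≤ eigenspace (Jmax A B) z := by
  intro y hy
  rw [Submodule.mem_orthogonal] at hy
  have h : act A B y = z • (y : ℕ+ → Block d) := by
    funext n
    refine ext_inner_left ℂ fun e => ?_
    have h := hy _ (LinearMap.mem_range_self _ ⟨lp.single 2 n e, single_mem_finiteSeq n e⟩)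
    rw [shift_apply, inner_sub_left, inner_Jmin_single hB, sub_eq_zero, inner_smul_left,
      Complex.conj_conj, lp.inner_single_left] at h
    rw [h, Pi.smul_apply, inner_smul_right]
  have hm : y ∈ maxDomain A B := by
    change Memℓp (act A B y) 2
    rw [h]
    exact (lp.memℓp y).const_smul z
  exact ⟨hm, Subtype.ext h⟩

/-- Invertibility of A_n lets the recurrence determine u_{n+1} from u_{n-1} and u_n. -/
theorem eq_zero_of_act_eq_smul (hA : ∀ n, IsUnit (A n)) {u : ℕ+ → Block d} {z : ℂ}
    (h : act A B u = z • u) (h1 : u 1 = 0) : u = 0 := by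
  have hinj : ∀ n x, (A n).toEuclideanLin x = 0 → x = 0 := by
    intro n x hx
    rw [Matrix.toLpLin_apply] at hx
    have := Matrix.mulVec_injective_of_isUnit (hA n) (a₁ := x.ofLp) (a₂ := 0) (by
      rw [Matrix.mulVec_zero]
      exact (WithLp.toLp_eq_zero 2).mp hx)
    exact (WithLp.ofLp_eq_zero 2).mp this
  have key : ∀ k : ℕ, u k.succPNat = 0 ∧ u (k + 1).succPNat = 0 := by
    intro k
    induction k with
    | zero =>
      refine ⟨h1, hinj _ _ (?_ : (A (Nat.succPNat 0)).toEuclideanLin _ = 0)⟩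
      have h2 := congrFun h (Nat.succPNat 0)
      have h1' : u (Nat.succPNat 0) = 0 := h1
      rwa [act_succPNat_zero, Pi.smul_apply, h1', map_zero, smul_zero, zero_add] at h2
    | succ k ih =>
      refine ⟨ih.2, hinj _ _ (?_ : (A (Nat.succPNat (k + 1))).toEuclideanLin _ = 0)⟩
      have h2 := congrFun h (Nat.succPNat (k + 1))
      rwa [act_succPNat_succ, Pi.smul_apply, ih.1, ih.2, map_zero, map_zero, smul_zero, zero_add,
        zero_add] at h2
  funext n
  have := (key n.natPred).1
  rwa [PNat.succPNat_natPred] at this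

/-- A solution is determined by its first block, so the space embeds in ℂ^d. -/
theorem finiteDimensional_eigenspace_Jmax (hA : ∀ n, IsUnit (A n)) (z : ℂ) :
    FiniteDimensional ℂ (eigenspace (Jmax A B) z) := by
  refine FiniteDimensional.of_injective (lp.evalₗ (𝕜 := ℂ) (fun _ : ℕ+ => Block d) 2 1 ∘ₗ
    (eigenspace (Jmax A B) z).subtype) ?_
  rw [← LinearMap.ker_eq_bot, Submodule.eq_bot_iff]
  rintro ⟨y, hy, e⟩ h
  have e' : act A B y = z • (y : ℕ+ → Block d) := congrArg Subtype.val e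
  exact Subtype.ext (Subtype.ext (eq_zero_of_act_eq_smul hA e' h))

theorem defectNumber_eq_finrank (hA : ∀ n, IsUnit (A n)) (z : ℂ) :
    defectNumber A B z = (Module.finrank ℂ (eigenspace (Jmax A B) z) : ℕ∞) := by
  have := finiteDimensional_eigenspace_Jmax (B := B) hA z
  rw [defectNumber, mult, ← Module.finrank_eq_rank, Cardinal.toENat_nat]

end JacobiMatrices

/-! ### Self-adjoint extensions of J_min: the lower bound and its spectral consequences. -/

section SelfAdjointExtensions

open Filter Topology ComplexConjugate ComplexOrder

variable {d : ℕ} {A B : ℕ+ → Matrix (Fin d) (Fin d) ℂ} {J : L2 d →ₗ.[ℂ] L2 d}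

theorem apply_of_Jmin_le (hext : Jmin A B ≤ J) (v : (Jmin A B).domain) :
    J ⟨v, hext.1 v.2⟩ = Jmin A B v := (hext.2 rfl).symm

/-- An element of the domain of a self-adjoint extension whose image under `J - conj z` is orthogonal
to the defect space `ker (J_max - z)` lies in the domain of the closure of `J_min`. -/
theorem exists_tendsto_of_mem_orthogonal (hB : ∀ n, (B n).IsHermitian) (hJ : IsSelfAdjoint J)
    (hext : Jmin A B ≤ J) {z : ℂ} (hz : z.im ≠ 0) (u : J.domain)
    (hu : shift J (conj z) u ∈ (eigenspace (Jmax A B) z)ᗮ) :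
    ∃ v : ℕ → (Jmin A B).domain, Tendsto (fun k => (v k : L2 d)) atTop (𝓝 u) ∧
      Tendsto (fun k => Jmin A B (v k)) atTop (𝓝 (J u)) := by
  -- The orthogonal complement of the defect space lies in the double complement of ran(J_min - z̄),
  -- that is, in its closure.
  have h1 : shift J (conj z) u ∈
      closure (LinearMap.range (shift (Jmin A B) (conj z)) : Set (L2 d)) := by
    rw [← Submodule.topologicalClosure_coe, SetLike.mem_coe,
      ← Submodule.orthogonal_orthogonal_eq_closure]
    exact Submodule.orthogonal_le (orthogonal_range_shift_Jmin_le hB z) hu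
  obtain ⟨w, hw, hwt⟩ := mem_closure_iff_seq_limit.mp h1
  choose v hv using hw
  have h2 : ∀ k, shift J (conj z) (⟨v k, hext.1 (v k).2⟩ - u) = w k - shift J (conj z) u := by
    intro k
    rw [map_sub, ← hv k, shift_apply, apply_of_Jmin_le hext, shift_apply (Jmin A B)]
  have hpos : 0 < |z.im| := abs_pos.mpr hz
  have hvt : Tendsto (fun k => (v k : L2 d)) atTop (𝓝 u) := by
    rw [tendsto_iff_norm_sub_tendsto_zero] at hwt ⊢
    refine squeeze_zero (fun _ => norm_nonneg _) (fun k => ?_)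
      (by simpa using hwt.const_mul |z.im|⁻¹)
    -- Convergence of the images under J - z̄ forces convergence of the preimages.
    have h3 := abs_im_mul_norm_le hJ (conj z) (⟨v k, hext.1 (v k).2⟩ - u)
    rw [← shift_apply, h2, Complex.conj_im, abs_neg] at h3
    rw [inv_mul_eq_div, le_div_iff₀' hpos]
    exact h3
  refine ⟨v, hvt, ?_⟩
  have h4 := hwt.add (hvt.const_smul (conj z))
  rw [shift_apply, sub_add_cancel] at h4
  refine h4.congr fun k => ?_
  rw [← hv k, shift_apply, sub_add_cancel]

theorem continuous_apply_L2 (n : ℕ+) : Continuous fun u : L2 d => u n :=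
  (lp.lipschitzWith_one_eval 2 n).continuous

/-- The first `K` blocks of `u`, together with the projection of `(J - conj z) u` to the defect
space `ker (J_max - z)`. -/
def boundaryMap (A B : ℕ+ → Matrix (Fin d) (Fin d) ℂ) (J : L2 d →ₗ.[ℂ] L2 d) (z : ℂ) (K : ℕ)
    [FiniteDimensional ℂ (eigenspace (Jmax A B) z)] :
    J.domain →ₗ[ℂ] (Fin K → Block d) × eigenspace (Jmax A B) z :=
  (LinearMap.pi fun k : Fin K =>
      lp.evalₗ (𝕜 := ℂ) (fun _ : ℕ+ => Block d) 2 (Nat.succPNat k) ∘ₗ J.domain.subtype).prod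
    ((eigenspace (Jmax A B) z).orthogonalProjectionOnto.toLinearMap ∘ₗ shift J (conj z))

variable {z : ℂ} {K : ℕ} [FiniteDimensional ℂ (eigenspace (Jmax A B) z)]

theorem boundaryMap_eq_zero_iff (u : J.domain) :
    boundaryMap A B J z K u = 0 ↔ (∀ k < K, (u : L2 d) (Nat.succPNat k) = 0) ∧
      (eigenspace (Jmax A B) z).orthogonalProjectionOnto (shift J (conj z) u) = 0 := by
  rw [Prod.ext_iff]
  refine and_congr ⟨fun h k hk => congrFun h ⟨k, hk⟩, fun h => funext fun k => h k k.2⟩ Iff.rfl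

theorem boundaryMap_eq_zero_of_tendsto (u : ℕ → J.domain) (x : J.domain)
    (h0 : ∀ k, boundaryMap A B J z K (u k) = 0)
    (hu : Tendsto (fun k => (u k : L2 d)) atTop (𝓝 x))
    (hJu : Tendsto (fun k => J (u k)) atTop (𝓝 (J x))) : boundaryMap A B J z K x = 0 := by
  simp only [boundaryMap_eq_zero_iff] at h0 ⊢
  refine ⟨fun j hj => ?_, ?_⟩
  · refine tendsto_nhds_unique (((continuous_apply_L2 (Nat.succPNat j)).tendsto _).comp hu) ?_
    exact tendsto_const_nhds.congr fun k => ((h0 k).1 j hj).symm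
  · have h1 := hJu.sub (hu.const_smul (conj z))
    refine tendsto_nhds_unique (((ContinuousLinearMap.continuous _).tendsto _).comp h1) ?_
    exact tendsto_const_nhds.congr fun k => (h0 k).2.symm

/-- The bound of `norm_Jmin_sub_lower_bound` on the kernel of the boundary map. -/
theorem mul_norm_le_norm_sub_of_boundaryMap_eq_zero (hB : ∀ n, (B n).IsHermitian)
    (hJ : IsSelfAdjoint J) (hext : Jmin A B ≤ J) (hz : z.im ≠ 0) {t δ : ℝ}
    (hK : ∀ k, K ≤ k → ∀ x : Block d, δ * ‖x‖ ^ 2 ≤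
      (-1 : ℝ) ^ k * ((inner ℂ ((B k.succPNat).toEuclideanLin x) x).re - t * ‖x‖ ^ 2))
    (u : J.domain) (hu : boundaryMap A B J z K u = 0) :
    δ * ‖(u : L2 d)‖ ≤ ‖J u - (t : ℂ) • (u : L2 d)‖ := by
  rw [boundaryMap_eq_zero_iff, Submodule.orthogonalProjectionOnto_eq_zero_iff] at hu
  obtain ⟨v, hv, hJv⟩ := exists_tendsto_of_mem_orthogonal hB hJ hext hz u hu.2
  have hL : Continuous fun w : L2 d => δ * ‖w‖ ^ 2 + ∑ k ∈ Finset.range K,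
      ((-1 : ℝ) ^ k * ((inner ℂ ((B k.succPNat).toEuclideanLin (w k.succPNat))
        (w k.succPNat)).re - t * ‖w k.succPNat‖ ^ 2) - δ * ‖w k.succPNat‖ ^ 2) := by
    have h1 := fun k : ℕ => continuous_apply_L2 (d := d) k.succPNat
    have h2 := fun k : ℕ =>
      (LinearMap.continuous_of_finiteDimensional (B k.succPNat).toEuclideanLin).comp (h1 k)
    have h3 := fun k : ℕ => Complex.continuous_re.comp ((h2 k).inner (𝕜 := ℂ) (h1 k))
    refine (by fun_prop : Continuous fun w : L2 d => δ * ‖w‖ ^ 2).add ?_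
    refine continuous_finsetSum _ fun k _ => ?_
    exact (continuous_const.mul ((h3 k).sub (continuous_const.mul ((h1 k).norm.pow 2)))).sub
      (continuous_const.mul ((h1 k).norm.pow 2))
  -- The approximants need not vanish on the first `K` blocks, so the inequality passes to the limit
  -- with its finite sum; that sum vanishes only at `u`.
  have h := le_of_tendsto_of_tendsto' ((hL.tendsto _).comp hv)
    ((hJv.sub (hv.const_smul (t : ℂ))).norm.mul hv.norm)
    fun k => norm_Jmin_sub_lower_bound hK (v k)
  rw [Finset.sum_eq_zero, add_zero] at h
  · rcases (norm_nonneg (u : L2 d)).eq_or_lt with h0 | h0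
    · rw [← h0, mul_zero]
      exact norm_nonneg _
    · rw [pow_two, ← mul_assoc] at h
      exact le_of_mul_le_mul_right h h0
  · intro k hk
    simp [hu.1 k (Finset.mem_range.mp hk)]

theorem TendsToInfinity.exists_le {C : ℕ+ → Matrix (Fin d) (Fin d) ℂ} (hC : TendsToInfinity C)
    (M : ℝ) : ∃ N : ℕ+, ∀ n, N ≤ n → (M : ℂ) • (1 : Matrix (Fin d) (Fin d) ℂ) ≤ C n := by
  obtain ⟨N, hN⟩ := hC (max M 0) (le_max_right _ _)
  refine ⟨N, fun n hn => le_trans ?_ (hN n hn)⟩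
  rw [Matrix.le_iff, ← sub_smul, ← Complex.ofReal_sub]
  refine Matrix.PosSemidef.one.smul ?_
  exact_mod_cast sub_nonneg.mpr (le_max_left M 0)

/-- The index k is zero-based: even k are the odd-numbered blocks, at least c + a, and odd k the
even-numbered ones, at most c. Both lie at distance at least a/2 from the midpoint c + a/2, on the
side given by the sign. -/
theorem alternating_diagonal_bound {c a : ℝ} {N₀ N : ℕ+}
    (heven : ∀ n, N₀ ≤ n → B (2 * n) ≤ (c : ℂ) • (1 : Matrix (Fin d) (Fin d) ℂ))
    (hodd : ∀ n, N ≤ n → ((c + a : ℝ) : ℂ) • (1 : Matrix (Fin d) (Fin d) ℂ) ≤ B (2 * n - 1))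
    (k : ℕ) (hk : ((max (2 * N₀) (2 * N - 1) : ℕ+) : ℕ) ≤ k) (x : Block d) :
    a / 2 * ‖x‖ ^ 2 ≤ (-1 : ℝ) ^ k *
      ((inner ℂ ((B k.succPNat).toEuclideanLin x) x).re - (c + a / 2) * ‖x‖ ^ 2) := by
  have hk1 : 2 * (N₀ : ℕ) ≤ k := le_trans (by exact_mod_cast le_max_left (2 * N₀) (2 * N - 1)) hk
  have hk2 : ((2 * N - 1 : ℕ+) : ℕ) ≤ k :=
    le_trans (by exact_mod_cast le_max_right (2 * N₀) (2 * N - 1)) hk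
  have hlt : ∀ m : ℕ+, (1 : ℕ+) < 2 * m := fun m => by
    rw [← PNat.coe_lt_coe, PNat.mul_coe]
    have := m.pos
    change 1 < 2 * (m : ℕ)
    omega
  have hsub : ∀ m : ℕ+, ((2 * m - 1 : ℕ+) : ℕ) = 2 * (m : ℕ) - 1 := fun m => by
    rw [PNat.sub_coe, if_pos (hlt m), PNat.mul_coe]
    rfl
  rw [hsub] at hk2
  obtain ⟨m, rfl | rfl⟩ := k.even_or_odd'
  · have e : (2 * m).succPNat = 2 * m.succPNat - 1 := by
      apply PNat.eq
      rw [hsub, Nat.succPNat_coe, Nat.succPNat_coe]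
      omega
    have h := re_inner_toEuclideanLin_mono (hodd m.succPNat (by
      rw [← PNat.coe_le_coe, Nat.succPNat_coe]
      omega)) x
    rw [re_inner_toEuclideanLin_smul_one, ← e] at h
    rw [pow_mul, neg_one_sq, one_pow, one_mul]
    linarith
  · have e : (2 * m + 1).succPNat = 2 * m.succPNat := by
      apply PNat.eq
      rw [PNat.mul_coe, Nat.succPNat_coe, Nat.succPNat_coe]
      change _ = 2 * _
      omega
    have h := re_inner_toEuclideanLin_mono (heven m.succPNat (by
      rw [← PNat.coe_le_coe, Nat.succPNat_coe]
      omega)) x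
    rw [re_inner_toEuclideanLin_smul_one, ← e] at h
    rw [pow_succ (-1 : ℝ), pow_mul, neg_one_sq, one_pow, one_mul]
    linarith

omit [FiniteDimensional ℂ (eigenspace (Jmax A B) z)] in
theorem eigenvalueCount_Ioo_le (hA : ∀ n, IsUnit (A n)) (hB : ∀ n, (B n).IsHermitian)
    (hJ : IsSelfAdjoint J) (hext : Jmin A B ≤ J) {c a : ℝ} {N₀ N : ℕ+}
    (heven : ∀ n, N₀ ≤ n → B (2 * n) ≤ (c : ℂ) • (1 : Matrix (Fin d) (Fin d) ℂ))
    (hodd : ∀ n, N ≤ n → ((c + a : ℝ) : ℂ) • (1 : Matrix (Fin d) (Fin d) ℂ) ≤ B (2 * n - 1))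
    (hz : z.im ≠ 0) :
    eigenvalueCount J (Set.Ioo c (c + a)) ≤
      (d : ℕ∞) * (((max (2 * N₀) (2 * N - 1) : ℕ+) : ℕ) : ℕ∞) + defectNumber A B z := by
  have hfin := finiteDimensional_eigenspace_Jmax (B := B) hA z
  have h := eigenvalueCount_le_finrank hJ
    (boundaryMap A B J z ((max (2 * N₀) (2 * N - 1) : ℕ+) : ℕ))
    (mul_norm_le_norm_sub_of_boundaryMap_eq_zero hB hJ hext hz
      (alternating_diagonal_bound heven hodd))
  rw [Module.finrank_prod, Module.finrank_pi_fintype, Finset.sum_const, Finset.card_univ,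
    Fintype.card_fin, finrank_euclideanSpace_fin, smul_eq_mul, mul_comm] at h
  rw [defectNumber_eq_finrank hA]
  convert h using 3
  · ring
  · ring
  · push_cast
    rfl

omit [FiniteDimensional ℂ (eigenspace (Jmax A B) z)] in
theorem inResolventSet_of_eigenspace_eq_bot (hA : ∀ n, IsUnit (A n))
    (hB : ∀ n, (B n).IsHermitian) (hJ : IsSelfAdjoint J) (hext : Jmin A B ≤ J) {c : ℝ} {N₀ : ℕ+}
    (heven : ∀ n, N₀ ≤ n → B (2 * n) ≤ (c : ℂ) • (1 : Matrix (Fin d) (Fin d) ℂ))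
    (hodd : TendsToInfinity fun n => B (2 * n - 1)) {t : ℝ} (ht : c < t)
    (hbot : eigenspace J t = ⊥) : InResolventSet J t := by
  have hfin := finiteDimensional_eigenspace_Jmax (B := B) hA Complex.I
  -- The choice a = 2(t - c) makes t the midpoint of (c, c + a).
  obtain ⟨N, hN⟩ := hodd.exists_le (c + 2 * (t - c))
  have hb := mul_norm_le_norm_sub_of_boundaryMap_eq_zero (z := Complex.I) hB hJ hext (by simp)
      (alternating_diagonal_bound heven hN)
  have e : c + 2 * (t - c) / 2 = t := by ring
  rw [e] at hb
  exact inResolventSet_of_finite_codim hJ (by linarith) _ boundaryMap_eq_zero_of_tendsto hb hbot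
    (by rwa [Complex.conj_ofReal])

omit [FiniteDimensional ℂ (eigenspace (Jmax A B) z)] in
theorem exists_mem_spectrum_gt (hd : 1 ≤ d) (hJ : IsSelfAdjoint J) (hext : Jmin A B ≤ J)
    (hodd : TendsToInfinity fun n => B (2 * n - 1)) (M : ℝ) :
    ∃ x : ℝ, M < x ∧ (x : ℂ) ∈ spectrum J := by
  by_contra! hcon
  have hres : ∀ x : ℝ, M < x → InResolventSet J x := fun x hx => not_not.mp (hcon x hx)
  -- The form of J would be at most M + 1 on unit vectors, while a unit vector in block 2N - 1 gives
  -- at least M + 2.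
  obtain ⟨N, hN⟩ := hodd.exists_le (M + 2)
  let e : Block d := EuclideanSpace.single ⟨0, hd⟩ 1
  have he : ‖e‖ = 1 := by simp [e]
  let v : (Jmin A B).domain := ⟨lp.single 2 (2 * N - 1) e, single_mem_finiteSeq _ e⟩
  have h := re_inner_le_of_forall_inResolventSet hJ hres (lt_add_one M) ⟨v, hext.1 v.2⟩
  rw [apply_of_Jmin_le hext] at h
  change (inner ℂ (Jmin A B v) (lp.single 2 (2 * N - 1) e)).re
    ≤ _ * ‖(lp.single 2 (2 * N - 1) e : L2 d)‖ ^ 2 at h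
  rw [lp.inner_single_right, lp.norm_single (by norm_num), he] at h
  have hact : Jmin A B v (2 * N - 1) = (B (2 * N - 1)).toEuclideanLin e := by
    have hv : ∀ n, n ≠ 2 * N - 1 → (v : L2 d) n = 0 := fun n hn => single_apply_of_ne e hn
    have hv' : (v : L2 d) (2 * N - 1) = e := Pi.single_eq_same _ _
    rw [Jmin_apply]
    obtain ⟨k, hk⟩ : ∃ k : ℕ, 2 * N - 1 = k.succPNat := ⟨(2 * N - 1).natPred, by simp⟩
    rw [hk] at hv hv' ⊢
    have hz : ∀ j, j ≠ k → (v : L2 d) (Nat.succPNat j) = 0 := fun j hj =>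
      hv _ fun h => hj (Nat.succPNat_injective h)
    cases k with
    | zero => rw [act_succPNat_zero, hv', hz 1 one_ne_zero, map_zero, add_zero]
    | succ k =>
      rw [act_succPNat_succ, hv', hz k (by omega), hz (k + 2) (by omega), map_zero, map_zero,
        zero_add, add_zero]
  rw [hact] at h
  have h2 := re_inner_toEuclideanLin_mono (hN N le_rfl) e
  rw [re_inner_toEuclideanLin_smul_one, he] at h2
  linarith

end SelfAdjointExtensions

/-! ### From finite eigenvalue counts to finite sets of eigenvalues. -/

section Counting

variable {H : Type*} [NormedAddCommGroup H] [InnerProductSpace ℂ H] {T : H →ₗ.[ℂ] H}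

theorem sum_mult_le_eigenvalueCount {I : Set ℝ} {s : Finset ℝ} (hs : (s : Set ℝ) ⊆ I) :
    ∑ x ∈ s, mult T (x : ℂ) ≤ eigenvalueCount T I :=
  le_iSup (fun s : {s : Finset ℝ // (s : Set ℝ) ⊆ I} => ∑ x ∈ s.1, mult T (x : ℂ)) ⟨s, hs⟩

theorem one_le_mult {z : ℂ} (h : eigenspace T z ≠ ⊥) : 1 ≤ mult T z := by
  have := Submodule.nontrivial_iff_ne_bot.mpr h
  rw [mult, ← map_one Cardinal.toENat]
  exact Cardinal.toENat.monotone' (Cardinal.one_le_iff_ne_zero.mpr rank_pos.ne')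

theorem finiteDimensional_eigenspace_of_eigenvalueCount_ne_top {I : Set ℝ}
    (h : eigenvalueCount T I ≠ ⊤) {x : ℝ} (hx : x ∈ I) :
    FiniteDimensional ℂ (eigenspace T x) := by
  have h1 := sum_mult_le_eigenvalueCount (T := T) (s := {x}) (I := I) (by simpa using hx)
  rw [Finset.sum_singleton] at h1
  have h2 : mult T x < ⊤ := h1.trans_lt (lt_top_iff_ne_top.mpr h)
  rw [mult, Cardinal.toENat_lt_top] at h2
  exact Module.rank_lt_aleph0_iff.mp h2

theorem finite_eigenvalues_of_eigenvalueCount_ne_top {I : Set ℝ} (h : eigenvalueCount T I ≠ ⊤) :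
    {x ∈ I | eigenspace T (x : ℂ) ≠ ⊥}.Finite := by
  by_contra hinf
  obtain ⟨n, hn⟩ := ENat.ne_top_iff_exists.mp h
  obtain ⟨s, hs, hcard⟩ := Set.Infinite.exists_subset_card_eq hinf (n + 1)
  have h1 := sum_mult_le_eigenvalueCount (T := T) (I := I) (fun x hx => (hs hx).1)
  have h2 : ((s.card : ℕ) : ℕ∞) ≤ ∑ x ∈ s, mult T (x : ℂ) := by
    have := Finset.sum_le_sum fun x hx => one_le_mult (hs (Finset.mem_coe.mpr hx)).2
    simpa using this
  have h3 := h2.trans h1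
  rw [← hn, hcard] at h3
  have : n + 1 ≤ n := by exact_mod_cast h3
  omega

theorem not_accPt_of_mem_nhds_of_finite {X : Type*} [TopologicalSpace X] [T1Space X] {x : X}
    {U S : Set X} (hU : U ∈ nhds x) (h : (U ∩ S).Finite) :
    ¬ AccPt x (Filter.principal S) := fun hx => (Set.Infinite.of_accPt (hx.nhds_inter hU)) h

end Counting

end BlockJacobi

end

theorem theorem2p1 (d : ℕ) (hd : 1 ≤ d)
    (A B : ℕ+ → Matrix (Fin d) (Fin d) ℂ)
    (hA : ∀ n, IsUnit (A n)) (hB : ∀ n, (B n).IsHermitian)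
    (c : ℝ) (N₀ : ℕ+)
    (heven : ∀ n, N₀ ≤ n → B (2 * n) ≤ (c : ℂ) • (1 : Matrix (Fin d) (Fin d) ℂ))
    (hodd : BlockJacobi.TendsToInfinity fun n => B (2 * n - 1))
    (J : BlockJacobi.L2 d →ₗ.[ℂ] BlockJacobi.L2 d)
    (hJ : IsSelfAdjoint J) (hext : BlockJacobi.Jmin A B ≤ J) :
    -- the spectrum is discrete in `(c, +∞)`
    (∀ x : ℝ, c < x → (x : ℂ) ∈ BlockJacobi.spectrum J →
      (x : ℂ) ∈ BlockJacobi.discreteSpectrum J) ∧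
    -- its part in `(c, +∞)` has `+∞` as its only accumulation point in `[-∞, +∞]`
    (∀ y : EReal,
      AccPt y (Filter.principal
        (Real.toEReal '' {x : ℝ | c < x ∧ (x : ℂ) ∈ BlockJacobi.spectrum J})) ↔ y = ⊤) ∧
    -- the counting bound; `z` ranges over the points at which the defect can be computed
    (∀ a : ℝ, 0 < a → ∀ N : ℕ+,
      (∀ n, N ≤ n → ((c + a : ℝ) : ℂ) • (1 : Matrix (Fin d) (Fin d) ℂ) ≤ B (2 * n - 1)) →
      ∀ z : ℂ, z.im ≠ 0 →
        BlockJacobi.eigenvalueCount J (Set.Ioo c (c + a)) ≤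
          (d : ℕ∞) * (((max (2 * N₀) (2 * N - 1) : ℕ+) : ℕ) : ℕ∞)
            + BlockJacobi.defectNumber A B z) := by
  have hcount : ∀ b : ℝ, BlockJacobi.eigenvalueCount J (Set.Ioo c b) ≠ ⊤ := by
    intro b
    obtain ⟨N, hN⟩ := hodd.exists_le (c + (b - c))
    have h := BlockJacobi.eigenvalueCount_Ioo_le hA hB hJ hext heven hN
      (z := Complex.I) (by simp)
    rw [BlockJacobi.defectNumber_eq_finrank hA, add_sub_cancel] at h
    refine ne_top_of_le_ne_top ?_ h
    exact_mod_cast ENat.natCast_ne_top _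
  have heig : ∀ x : ℝ, c < x → (x : ℂ) ∈ BlockJacobi.spectrum J →
      BlockJacobi.eigenspace J x ≠ ⊥ := fun x hx hs hbot =>
    hs (BlockJacobi.inResolventSet_of_eigenspace_eq_bot hA hB hJ hext heven hodd hx hbot)
  have hfin : ∀ b : ℝ, {x : ℝ | x < b ∧ c < x ∧ (x : ℂ) ∈ BlockJacobi.spectrum J}.Finite :=
    fun b => (BlockJacobi.finite_eigenvalues_of_eigenvalueCount_ne_top (hcount b)).subset
      fun x hx => ⟨⟨hx.2.1, hx.1⟩, heig x hx.2.1 hx.2.2⟩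
  refine ⟨fun x hx hs => ⟨hs, ?_, heig x hx hs, ?_⟩, fun y => ⟨fun hy => ?_, ?_⟩, ?_⟩
  -- The spectrum is real, so a vertical strip around x meets it in finitely many points.
  · refine BlockJacobi.not_accPt_of_mem_nhds_of_finite (U := Complex.re ⁻¹' Set.Ioo c (x + 1))
      (Complex.continuous_re.continuousAt.preimage_mem_nhds (Ioo_mem_nhds hx (by simp)))
      (((hfin (x + 1)).image ((↑) : ℝ → ℂ)).subset ?_)
    rintro w ⟨hw, hws⟩
    have him : w.im = 0 := by
      by_contra h
      exact hws (BlockJacobi.inResolventSet_of_im_ne_zero hJ h)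
    have e : ((w.re : ℝ) : ℂ) = w := Complex.ext rfl (by simp [him])
    exact ⟨w.re, ⟨hw.2, hw.1, by rwa [e]⟩, e⟩
  · exact BlockJacobi.finiteDimensional_eigenspace_of_eigenvalueCount_ne_top (hcount (x + 1))
      ⟨hx, by simp⟩
  · by_contra hne
    -- Only finitely many spectral points above c lie below b, which excludes every y < ⊤ at once,
    -- including ⊥ and c.
    obtain ⟨b, hb, -⟩ := EReal.lt_iff_exists_real_btwn.mp (lt_top_iff_ne_top.mpr hne)
    refine BlockJacobi.not_accPt_of_mem_nhds_of_finite (Iio_mem_nhds hb)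
      (((hfin b).image Real.toEReal).subset ?_) hy
    rintro _ ⟨hw, x, hx, rfl⟩
    exact ⟨x, ⟨EReal.coe_lt_coe_iff.mp hw, hx⟩, rfl⟩
  · rintro rfl
    rw [accPt_iff_nhds]
    intro U hU
    obtain ⟨b, hb⟩ := EReal.mem_nhds_top_iff.mp hU
    obtain ⟨x, hx, hs⟩ := BlockJacobi.exists_mem_spectrum_gt hd hJ hext hodd (max b c)
    rw [max_lt_iff] at hx
    exact ⟨x, ⟨hb (EReal.coe_lt_coe_iff.mpr hx.1), x, ⟨hx.2, hs⟩, rfl⟩, EReal.coe_ne_top x⟩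
  · exact fun a _ N hN z hz => BlockJacobi.eigenvalueCount_Ioo_le hA hB hJ hext heven hN hz
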